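/- Let $(X_n)$ be a homogeneous Markov chain on a measurable space $S$ whose $\sigma$-algebra contains all one-point sets, with $n$-step transition probabilities $\mathbb P_x(n,\cdot)$ and $\mathbb P_x(0,\cdot)=\delta_x$. Let $\mu$ be a stationary probability measure of the chain, and let $m\ge 1$ be an integer. For $x,x'\in S$ put $$\kappa^{(m)}(x,x')=\int\Big(\frac{\mathbb P_{x'}(m,dy)}{\mathbb P_x(m,dy)}\wedge 1\Big)\,\mathbb P_x(m,dy),$$ where the fraction is the density of the absolutely continuous component. Let $\Lambda^{(m)}_{x,x'}=\tfrac12(\mathbb P_x(m,\cdot)+\mathbb P_{x'}(m,\cdot))$, and let $p(x,\cdot),p(x',\cdot)$ be the densities of $\mathbb P_x(m,\cdot),\mathbb P_{x'}(m,\cdot)$ with respect to $\Lambda^{(m)}_{x,x'}$. Given $x=(x^1,x^2)\in S^2$, let $\eta^1,\eta^2$ be independent random elements of $S$ whose densities with respect to $\Lambda^{(m)}_{x^1,x^2}$ are, respectively, $$\frac{p(x^1,u)-p(x^1,u)\wedge p(x^2,u)}{1-\kappa^{(m)}(x^1,x^2)},\qquad \frac{p(x^2,u)-p(x^1,u)\wedge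 p(x^2,u)}{1-\kappa^{(m)}(x^1,x^2)}$$ if $\kappa^{(m)}(x^1,x^2)<1$, and which both have the law $\mathbb P_{x^1}(m,\cdot)$ if $\kappa^{(m)}(x^1,x^2)=1$. (So $(\eta^1,\eta^2)$ is the coupled pair of two copies of the $m$-step chain after one $m$-step transition from $(x^1,x^2)$, conditioned on the coupling not having occurred.) Assume, as is automatic if the $\sigma$-algebra of $S$ is countably generated, that $\kappa^{(m)}(x^1,x^2)$ and the law of $(\eta^1,\eta^2)$ depend measurably on $(x^1,x^2)$. Let $V^{(m)}$ be the operator $$V^{(m)}h(x)=\big(1-\kappa^{(m)}(x^1,x^2)\big)\,\mathbb E_{x^1,x^2}\,h(\eta^1,\eta^2)$$ on the bounded measurable functions on $S^2$ with the supremum norm, and let $r(V^{(m)})$ be its spectral radius (taken on the complex-valued functions). Let $\mathbf 1$ be the function identically equal to one, let $\|\nu\|_{TV}=|\nu|(S)$ be the total variation norm, let $[\cdot]$ be the integer part, and let $\ln 0=-\infty$. Then for every $x^1\in S$ $$\limsup_{n\to\infty}\frac1n\ln\|\mathbb P_{x^1}(n,\cdot)-\mu\|_{TV}\le\limsup_{n\to\infty}\frac1n\ln\int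 2\,(V^{(m)})^{[n/m]}\mathbf 1(x^1,x^2)\,1(x^1\ne x^2)\,\mu(dx^2)\le\ln\Big(r(V^{(m)})^{1/m}\Big).$$ -/

import Mathlib

open MeasureTheory ProbabilityTheory Filter Topology
open scoped ENNReal

noncomputable section

namespace MarkovCoupling

/-! ### Bounded measurable functions -/

/-- The space of bounded measurable functions `X → 𝕜` with the supremum norm (as a subspace of
the space of all bounded functions). -/
def BddMeas (𝕜 : Type*) [RCLike 𝕜] (X : Type*) [MeasurableSpace X] :
    Submodule 𝕜 (lp (fun _ : X => 𝕜) ∞) where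
  carrier := {f | Measurable (f : X → 𝕜)}
  add_mem' {f g} hf hg := by
    have : Measurable fun x => (f : X → 𝕜) x + (g : X → 𝕜) x := Measurable.add hf hg
    exact this
  zero_mem' := by
    have : Measurable fun _ : X => (0 : 𝕜) := measurable_const
    exact this
  smul_mem' c f hf := by
    have : Measurable fun x => c • (f : X → 𝕜) x := Measurable.const_smul hf c
    exact this

namespace BddMeas

variable {𝕜 : Type*} [RCLike 𝕜] {X : Type*} [MeasurableSpace X]

instance : CoeFun (BddMeas 𝕜 X) (fun _ => X → 𝕜) := ⟨fun f => ((f : lp (fun _ : X => 𝕜) ∞) : X → 𝕜)⟩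

lemma measurable (f : BddMeas 𝕜 X) : Measurable (f : X → 𝕜) := f.2

lemma norm_apply_le (f : BddMeas 𝕜 X) (x : X) : ‖f x‖ ≤ ‖f‖ :=
  lp.norm_apply_le_norm (by simp) (f : lp (fun _ : X => 𝕜) ∞) x

/-- A measurable function with a uniform bound, as an element of `BddMeas`. -/
def mk (f : X → 𝕜) (hf : Measurable f) (C : ℝ) (hC : ∀ x, ‖f x‖ ≤ C) : BddMeas 𝕜 X :=
  ⟨⟨f, memℓp_infty ⟨C, by rintro _ ⟨x, rfl⟩; exact hC x⟩⟩, hf⟩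

@[simp] lemma mk_apply (f : X → 𝕜) (hf : Measurable f) (C : ℝ) (hC : ∀ x, ‖f x‖ ≤ C) (x : X) :
    mk f hf C hC x = f x := rfl

lemma ext' {f g : BddMeas 𝕜 X} (h : ∀ x, f x = g x) : f = g :=
  Subtype.ext (lp.ext (funext h))

lemma norm_le {f : BddMeas 𝕜 X} {C : ℝ} (hC : 0 ≤ C) (h : ∀ x, ‖f x‖ ≤ C) : ‖f‖ ≤ C :=
  lp.norm_le_of_forall_le hC h

variable (𝕜 X) in
/-- The function identically equal to one. -/
def one : BddMeas 𝕜 X := mk (fun _ => 1) measurable_const 1 (by simp)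

end BddMeas

/-! ### Ergodic coefficient and coupling -/

variable {S : Type*} [MeasurableSpace S]

instance isMarkovKernel_pow (P : Kernel S S) [IsMarkovKernel P] (m : ℕ) :
    IsMarkovKernel (P ^ m) := by
  induction m with
  | zero => rw [pow_zero]; exact (inferInstance : IsMarkovKernel (Kernel.id : Kernel S S))
  | succ k ih =>
    rw [pow_succ]
    exact (inferInstance : IsMarkovKernel ((P ^ k) ∘ₖ P))

/-- The Markov–Dobrushin coefficient
`κ(x, x') = ∫ (dQ_{x'} / dQ_x ∧ 1) dQ_x` of a transition kernel `Q`, where `dQ_{x'} / dQ_x` is the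
density of the absolutely continuous part. The `m`-step coefficient `κ^{(m)}(x, x')` of a chain
with kernel `P` is `kappa (P ^ m) x x'`. -/
def kappa (Q : Kernel S S) (x x' : S) : ℝ≥0∞ :=
  ∫⁻ y, min ((Q x').rnDeriv (Q x) y) 1 ∂(Q x)

/-- The reference measure `Λ_{x,x'} = (Q_x + Q_{x'}) / 2`. -/
def refMeasure (Q : Kernel S S) (x x' : S) : Measure S :=
  (2 : ℝ≥0∞)⁻¹ • (Q x + Q x')

/-- The density of `Q_z` with respect to `Λ_{x,x'}` (used for `z = x` and `z = x'`). -/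
def dens (Q : Kernel S S) (x x' z : S) (u : S) : ℝ≥0∞ :=
  (Q z).rnDeriv (refMeasure Q x x') u

open Classical in
/-- The law of `η¹₁` given `(η¹₀, η²₀) = (x, x')`: its density with respect to `Λ_{x,x'}` is
`(p(x,u) - p(x,u) ∧ p(x',u)) / (1 - κ(x,x'))` if `κ(x,x') < 1`, and it is `Q_x` if
`κ(x,x') = 1`. -/
def etaLaw₁ (Q : Kernel S S) (x x' : S) : Measure S :=
  if kappa Q x x' = 1 then Q x else
    (refMeasure Q x x').withDensity fun u =>
      (dens Q x x' x u - min (dens Q x x' x u) (dens Q x x' x' u)) / (1 - kappa Q x x')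

open Classical in
/-- The law of `η²₁` given `(η¹₀, η²₀) = (x, x')`: its density with respect to `Λ_{x,x'}` is
`(p(x',u) - p(x,u) ∧ p(x',u)) / (1 - κ(x,x'))` if `κ(x,x') < 1`, and it is `Q_x` if
`κ(x,x') = 1`. -/
def etaLaw₂ (Q : Kernel S S) (x x' : S) : Measure S :=
  if kappa Q x x' = 1 then Q x else
    (refMeasure Q x x').withDensity fun u =>
      (dens Q x x' x' u - min (dens Q x x' x u) (dens Q x x' x' u)) / (1 - kappa Q x x')

/-- The transition law of the pair `(η¹, η²)`, i.e. of the coupled pair on the event that the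
coupling has not occurred: given the present state `x = (x¹, x²)`, the two components are
independent. -/
def etaLaw (Q : Kernel S S) (x : S × S) : Measure (S × S) :=
  (etaLaw₁ Q x.1 x.2).prod (etaLaw₂ Q x.1 x.2)

/-- The coefficient `κ` and the transition law of `(η¹, η²)` are measurable functions of the
present state, that is, `(η¹, η²)` is a Markov chain on `S × S` in the usual sense. This is
automatic if the sigma-algebra of `S` is countably generated
(`couplingMeasurable_of_countablyGenerated`). -/
def CouplingMeasurable (Q : Kernel S S) : Prop :=
  Measurable (fun x : S × S => kappa Q x.1 x.2) ∧ Measurable (etaLaw Q)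

/-! ### Facts that are needed to see that `V` is a bounded operator -/

lemma kappa_le_one (Q : Kernel S S) [IsMarkovKernel Q] (x x' : S) : kappa Q x x' ≤ 1 := by
  calc kappa Q x x' ≤ ∫⁻ _, 1 ∂(Q x) := lintegral_mono fun y => min_le_right _ _
    _ = 1 := by simp

instance (Q : Kernel S S) [IsMarkovKernel Q] (x x' : S) : IsFiniteMeasure (refMeasure Q x x') := by
  refine ⟨?_⟩
  simp only [refMeasure, Measure.smul_apply, Measure.add_apply, measure_univ, smul_eq_mul]
  exact ENNReal.mul_lt_top (by simp) (by simp)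

lemma ac_left (Q : Kernel S S) (x x' : S) : Q x ≪ refMeasure Q x x' := by
  refine Measure.AbsolutelyContinuous.mk fun s _ h => ?_
  simp only [refMeasure, Measure.smul_apply, Measure.add_apply, smul_eq_mul, mul_eq_zero,
    ENNReal.inv_eq_zero, ENNReal.ofNat_ne_top, false_or, add_eq_zero] at h
  exact h.1

lemma ac_right (Q : Kernel S S) (x x' : S) : Q x' ≪ refMeasure Q x x' := by
  refine Measure.AbsolutelyContinuous.mk fun s _ h => ?_
  simp only [refMeasure, Measure.smul_apply, Measure.add_apply, smul_eq_mul, mul_eq_zero,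
    ENNReal.inv_eq_zero, ENNReal.ofNat_ne_top, false_or, add_eq_zero] at h
  exact h.2

lemma measurable_dens (Q : Kernel S S) (x x' z : S) : Measurable (dens Q x x' z) :=
  Measure.measurable_rnDeriv _ _

/-- `κ(x,x') = ∫ (p(x,u) ∧ p(x',u)) Λ_{x,x'}(du)`. -/
lemma kappa_eq (Q : Kernel S S) [IsMarkovKernel Q] (x x' : S) :
    kappa Q x x' = ∫⁻ u, min (dens Q x x' x u) (dens Q x x' x' u) ∂(refMeasure Q x x') := by
  have hw : (refMeasure Q x x').withDensity (dens Q x x' x) = Q x :=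
    Measure.withDensity_rnDeriv_eq _ _ (ac_left Q x x')
  have h1 : (Q x').rnDeriv (Q x) =ᵐ[Q x] fun u => dens Q x x' x' u / dens Q x x' x u :=
    Measure.rnDeriv_eq_div (ac_right Q x x') (ac_left Q x x')
  have h2 : kappa Q x x' = ∫⁻ u, min (dens Q x x' x' u / dens Q x x' x u) 1 ∂(Q x) := by
    refine lintegral_congr_ae ?_
    filter_upwards [h1] with u hu
    rw [hu]
  have hm : Measurable fun u => min (dens Q x x' x' u / dens Q x x' x u) (1 : ℝ≥0∞) :=
    ((measurable_dens Q x x' x').div (measurable_dens Q x x' x)).min measurable_const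
  rw [h2]
  conv_lhs => rw [← hw]
  rw [lintegral_withDensity_eq_lintegral_mul _ (measurable_dens Q x x' x) hm]
  refine lintegral_congr_ae ?_
  filter_upwards [Measure.rnDeriv_lt_top (Q x) (refMeasure Q x x')] with u hu
  change dens Q x x' x u < ∞ at hu
  rcases eq_or_ne (dens Q x x' x u) 0 with h0 | h0
  · simp [h0]
  · simp only [Pi.mul_apply]
    rw [mul_min, mul_one, ENNReal.mul_div_cancel h0 hu.ne, min_comm]

lemma lintegral_dens_left (Q : Kernel S S) [IsMarkovKernel Q] (x x' : S) :
    ∫⁻ u, dens Q x x' x u ∂(refMeasure Q x x') = 1 := by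
  simp only [dens]
  rw [Measure.lintegral_rnDeriv (ac_left Q x x')]; simp

lemma lintegral_dens_right (Q : Kernel S S) [IsMarkovKernel Q] (x x' : S) :
    ∫⁻ u, dens Q x x' x' u ∂(refMeasure Q x x') = 1 := by
  simp only [dens]
  rw [Measure.lintegral_rnDeriv (ac_right Q x x')]; simp

lemma lintegral_sub_min (Q : Kernel S S) [IsMarkovKernel Q] (x x' z : S)
    (hz : ∫⁻ u, dens Q x x' z u ∂(refMeasure Q x x') = 1)
    (hle : ∀ u, min (dens Q x x' x u) (dens Q x x' x' u) ≤ dens Q x x' z u)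
    (hk : kappa Q x x' ≠ 1) :
    ∫⁻ u, (dens Q x x' z u - min (dens Q x x' x u) (dens Q x x' x' u)) / (1 - kappa Q x x')
      ∂(refMeasure Q x x') = 1 := by
  have hlt : kappa Q x x' < 1 := lt_of_le_of_ne (kappa_le_one Q x x') hk
  have hmin : Measurable fun u => min (dens Q x x' x u) (dens Q x x' x' u) :=
    (measurable_dens Q x x' x).min (measurable_dens Q x x' x')
  simp only [div_eq_mul_inv]
  have hsub : Measurable fun u =>
      dens Q x x' z u - min (dens Q x x' x u) (dens Q x x' x' u) :=
    (measurable_dens Q x x' z).sub hmin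
  rw [lintegral_mul_const _ hsub,
    lintegral_sub hmin (by rw [← kappa_eq]; exact (hlt.trans ENNReal.one_lt_top).ne)
      (ae_of_all _ hle), hz, ← kappa_eq]
  exact ENNReal.mul_inv_cancel (tsub_pos_of_lt hlt).ne' (by simp)

instance (Q : Kernel S S) [IsMarkovKernel Q] (x x' : S) : IsProbabilityMeasure (etaLaw₁ Q x x') := by
  unfold etaLaw₁
  split_ifs with hk
  · infer_instance
  · refine ⟨?_⟩
    rw [withDensity_apply _ MeasurableSet.univ, Measure.restrict_univ]
    exact lintegral_sub_min Q x x' x (lintegral_dens_left Q x x') (fun u => min_le_left _ _) hk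

instance (Q : Kernel S S) [IsMarkovKernel Q] (x x' : S) : IsProbabilityMeasure (etaLaw₂ Q x x') := by
  unfold etaLaw₂
  split_ifs with hk
  · infer_instance
  · refine ⟨?_⟩
    rw [withDensity_apply _ MeasurableSet.univ, Measure.restrict_univ]
    exact lintegral_sub_min Q x x' x' (lintegral_dens_right Q x x') (fun u => min_le_right _ _) hk

instance (Q : Kernel S S) [IsMarkovKernel Q] (x : S × S) : IsProbabilityMeasure (etaLaw Q x) := by
  unfold etaLaw; infer_instance

/-- The measurability condition holds whenever the sigma-algebra of `S` is countably generated. -/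
lemma couplingMeasurable_of_countablyGenerated [MeasurableSpace.CountablyGenerated S]
    (Q : Kernel S S) [IsMarkovKernel Q] : CouplingMeasurable Q := by
  let Q₁ : Kernel (S × S) S := Q.comap Prod.fst measurable_fst
  let Q₂ : Kernel (S × S) S := Q.comap Prod.snd measurable_snd
  have hL : Measurable fun x : S × S => refMeasure Q x.1 x.2 := by
    refine Measure.measurable_of_measurable_coe _ fun s hs => ?_
    simp only [refMeasure, Measure.smul_apply, Measure.add_apply, smul_eq_mul]
    exact (((Q.measurable_coe hs).comp measurable_fst).add
      ((Q.measurable_coe hs).comp measurable_snd)).const_mul _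
  let L : Kernel (S × S) S := ⟨fun x => refMeasure Q x.1 x.2, hL⟩
  have : IsFiniteKernel L := by
    refine ⟨⟨1, by simp, fun x => le_of_eq ?_⟩⟩
    change refMeasure Q x.1 x.2 Set.univ = 1
    simp only [refMeasure, Measure.smul_apply, Measure.add_apply, measure_univ, smul_eq_mul]
    rw [one_add_one_eq_two]
    exact ENNReal.inv_mul_cancel (by simp) (by simp)
  have e₁ : ∀ x : S × S, Q₁.rnDeriv L x =ᵐ[refMeasure Q x.1 x.2] dens Q x.1 x.2 x.1 := fun x =>
    Kernel.rnDeriv_eq_rnDeriv_measure (κ := Q₁) (η := L) (a := x)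
  have e₂ : ∀ x : S × S, Q₂.rnDeriv L x =ᵐ[refMeasure Q x.1 x.2] dens Q x.1 x.2 x.2 := fun x =>
    Kernel.rnDeriv_eq_rnDeriv_measure (κ := Q₂) (η := L) (a := x)
  have m₁ := Kernel.measurable_rnDeriv Q₁ L
  have m₂ := Kernel.measurable_rnDeriv Q₂ L
  have hk : Measurable fun x : S × S => kappa Q x.1 x.2 := by
    have : (fun x : S × S => kappa Q x.1 x.2)
        = fun x => ∫⁻ u, min (Q₁.rnDeriv L x u) (Q₂.rnDeriv L x u) ∂(L x) := by
      funext x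
      rw [kappa_eq]
      refine lintegral_congr_ae ?_
      filter_upwards [e₁ x, e₂ x] with u h1 h2
      rw [h1, h2]
    rw [this]
    exact Measurable.lintegral_kernel_prod_right' (κ := L) (m₁.min m₂)
  have hs : MeasurableSet {x : S × S | kappa Q x.1 x.2 = 1} := hk (measurableSet_singleton 1)
  have hE₁ : Measurable fun x : S × S => etaLaw₁ Q x.1 x.2 := by
    refine Measurable.ite hs (Q.measurable.comp measurable_fst) ?_
    refine Measure.measurable_of_measurable_coe _ fun s hms => ?_
    have : ∀ x : S × S, ((refMeasure Q x.1 x.2).withDensity fun u =>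
        (dens Q x.1 x.2 x.1 u - min (dens Q x.1 x.2 x.1 u) (dens Q x.1 x.2 x.2 u))
          / (1 - kappa Q x.1 x.2)) s
        = ∫⁻ u in s, (Q₁.rnDeriv L x u - min (Q₁.rnDeriv L x u) (Q₂.rnDeriv L x u))
          / (1 - kappa Q x.1 x.2) ∂(L x) := by
      intro x
      rw [withDensity_apply _ hms]
      refine lintegral_congr_ae (ae_restrict_of_ae ?_)
      filter_upwards [e₁ x, e₂ x] with u h1 h2
      rw [h1, h2]
    simp_rw [this]
    exact Measurable.setLIntegral_kernel_prod_right (κ := L)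
      (f := fun x u => (Q₁.rnDeriv L x u - min (Q₁.rnDeriv L x u) (Q₂.rnDeriv L x u))
        / (1 - kappa Q x.1 x.2))
      ((m₁.sub (m₁.min m₂)).div (measurable_const.sub (hk.comp measurable_fst))) hms
  have hE₂ : Measurable fun x : S × S => etaLaw₂ Q x.1 x.2 := by
    refine Measurable.ite hs (Q.measurable.comp measurable_fst) ?_
    refine Measure.measurable_of_measurable_coe _ fun s hms => ?_
    have : ∀ x : S × S, ((refMeasure Q x.1 x.2).withDensity fun u =>
        (dens Q x.1 x.2 x.2 u - min (dens Q x.1 x.2 x.1 u) (dens Q x.1 x.2 x.2 u))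
          / (1 - kappa Q x.1 x.2)) s
        = ∫⁻ u in s, (Q₂.rnDeriv L x u - min (Q₁.rnDeriv L x u) (Q₂.rnDeriv L x u))
          / (1 - kappa Q x.1 x.2) ∂(L x) := by
      intro x
      rw [withDensity_apply _ hms]
      refine lintegral_congr_ae (ae_restrict_of_ae ?_)
      filter_upwards [e₁ x, e₂ x] with u h1 h2
      rw [h1, h2]
    simp_rw [this]
    exact Measurable.setLIntegral_kernel_prod_right (κ := L)
      (f := fun x u => (Q₂.rnDeriv L x u - min (Q₁.rnDeriv L x u) (Q₂.rnDeriv L x u))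
        / (1 - kappa Q x.1 x.2))
      ((m₂.sub (m₁.min m₂)).div (measurable_const.sub (hk.comp measurable_fst))) hms
  refine ⟨hk, ?_⟩
  let E₁ : Kernel (S × S) S := ⟨fun x => etaLaw₁ Q x.1 x.2, hE₁⟩
  let E₂ : Kernel (S × S) S := ⟨fun x => etaLaw₂ Q x.1 x.2, hE₂⟩
  have : IsMarkovKernel E₁ :=
    ⟨fun x => (inferInstance : IsProbabilityMeasure (etaLaw₁ Q x.1 x.2))⟩
  have : IsMarkovKernel E₂ :=
    ⟨fun x => (inferInstance : IsProbabilityMeasure (etaLaw₂ Q x.1 x.2))⟩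
  have : etaLaw Q = fun x => (E₁ ×ₖ E₂) x := by
    funext x
    rw [Kernel.prod_apply]; rfl
  rw [this]
  exact (E₁ ×ₖ E₂).measurable

/-! ### The operator `V` -/

variable {𝕜 : Type*} [RCLike 𝕜]

/-- `(V h)(x) = (1 - κ(x¹, x²)) 𝔼_{x¹,x²} h(η¹₁, η²₁)`. -/
def Vfun (Q : Kernel S S) (h : S × S → 𝕜) (x : S × S) : 𝕜 :=
  (((1 - kappa Q x.1 x.2).toReal : ℝ) : 𝕜) * ∫ y, h y ∂(etaLaw Q x)

lemma measurable_Vfun {Q : Kernel S S} [IsMarkovKernel Q] (hQ : CouplingMeasurable Q)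
    {h : S × S → 𝕜} (hh : Measurable h) : Measurable (Vfun Q h) := by
  let E : Kernel (S × S) (S × S) := ⟨etaLaw Q, hQ.2⟩
  have : IsMarkovKernel E := ⟨fun x => (inferInstance : IsProbabilityMeasure (etaLaw Q x))⟩
  have h1 : Measurable fun x => ∫ y, h y ∂(E x) :=
    (StronglyMeasurable.integral_kernel (κ := E) hh.stronglyMeasurable).measurable
  exact (RCLike.measurable_ofReal.comp (measurable_const.sub hQ.1).ennreal_toReal).mul h1

lemma norm_Vfun_le (Q : Kernel S S) [IsMarkovKernel Q] (h : BddMeas 𝕜 (S × S)) (x : S × S) :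
    ‖Vfun Q h x‖ ≤ ‖h‖ := by
  have h1 : ‖(((1 - kappa Q x.1 x.2).toReal : ℝ) : 𝕜)‖ ≤ 1 := by
    rw [RCLike.norm_ofReal, abs_of_nonneg ENNReal.toReal_nonneg]
    exact ENNReal.toReal_le_of_le_ofReal zero_le_one (by simp)
  have h2 : ‖∫ y, h y ∂(etaLaw Q x)‖ ≤ ‖h‖ := by
    have := norm_integral_le_of_norm_le_const (μ := etaLaw Q x)
      (ae_of_all _ fun y => BddMeas.norm_apply_le h y)
    simpa using this
  calc ‖Vfun Q h x‖ ≤ 1 * ‖h‖ := by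
        unfold Vfun
        rw [norm_mul]
        exact mul_le_mul h1 h2 (norm_nonneg _) zero_le_one
    _ = ‖h‖ := one_mul _

lemma integrable_etaLaw (Q : Kernel S S) [IsMarkovKernel Q] (h : BddMeas 𝕜 (S × S)) (x : S × S) :
    Integrable (h : S × S → 𝕜) (etaLaw Q x) :=
  Integrable.of_bound (BddMeas.measurable h).aestronglyMeasurable ‖h‖
    (ae_of_all _ (BddMeas.norm_apply_le h))

variable (𝕜) in
/-- The operator `V` of the chain with transition kernel `Q`, acting on the bounded measurable
functions on `S × S`:  `(V h)(x) = (1 - κ(x¹, x²)) 𝔼_{x¹,x²} h(η¹₁, η²₁)`. The `m`-step operator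
`V^{(m)}` of a chain with kernel `P` is the operator `V` of the chain with kernel `P ^ m`. -/
def V (Q : Kernel S S) [IsMarkovKernel Q] (hQ : CouplingMeasurable Q) :
    BddMeas 𝕜 (S × S) →L[𝕜] BddMeas 𝕜 (S × S) :=
  LinearMap.mkContinuous
    { toFun := fun h => BddMeas.mk (Vfun Q h) (measurable_Vfun hQ (BddMeas.measurable h)) ‖h‖
        (norm_Vfun_le Q h)
      map_add' := fun f g => BddMeas.ext' fun x => by
        change Vfun Q (fun y => f y + g y) x = Vfun Q f x + Vfun Q g x
        simp only [Vfun]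
        rw [integral_add (integrable_etaLaw Q f x) (integrable_etaLaw Q g x), mul_add]
      map_smul' := fun c f => BddMeas.ext' fun x => by
        change Vfun Q (fun y => c * f y) x = c * Vfun Q f x
        simp only [Vfun]
        rw [integral_const_mul, mul_left_comm] }
    1 (fun h => by
      rw [one_mul]
      exact BddMeas.norm_le (norm_nonneg h) (norm_Vfun_le Q h))

/-- The total variation norm `‖μ - ν‖_TV = |μ - ν|(S)` (equal to `2 sup_A |μ(A) - ν(A)|` for
probability measures). -/
def tvNorm (μ ν : Measure S) [IsFiniteMeasure μ] [IsFiniteMeasure ν] : ℝ≥0∞ :=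
  (μ.toSignedMeasure - ν.toSignedMeasure).totalVariation Set.univ

end MarkovCoupling

end

noncomputable section

namespace MarkovCoupling

variable {S : Type*} [MeasurableSpace S]

/-! ### Differences of transition probabilities -/

/-! The argument is analytic: no coupled process is built. Write `Q = P ^ m`. For every pair `(x,
x')`, both `Q x` and `Q x'` split as the common part of mass `κ(x, x')` plus `1 - κ(x, x')` times
the law of `η¹`, respectively `η²`. In the difference of the integrals of a bounded `g` the common
parts cancel, leaving exactly `V` applied to `(y, y') ↦ g y - g y'`
(`integral_sub_integral_eq_Vfun`). So passing to differences intertwines `Q` with `V`, and hence `Q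
^ k` with `V ^ k` (`difference_average_pow`).

Take for `g` the probability of being in `A` after the remaining `n % m` steps. Its differences are
bounded by `1`, and `V` is positive, so `P^n(x, A)` and `P^n(x', A)` differ by at most `V^[n/m] 1
(x, x')`, and by `0` if `x = x'` (`abs_real_sub_real_le`). Integrating `x'` against the stationary
`μ` and taking the worst `A` bounds the total variation distance for each `n`; this gives the first
inequality. For the second, the integral is at most `2 ‖V^[n/m]‖`, and Gelfand's formula applies. -/

/-- The measure with density `p(x,u) ∧ p(x',u)` with respect to `Λ_{x,x'}`. -/
def commonPart (Q : Kernel S S) (x x' : S) : Measure S :=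
  (refMeasure Q x x').withDensity fun u => min (dens Q x x' x u) (dens Q x x' x' u)

lemma measurable_min_dens (Q : Kernel S S) (x x' : S) :
    Measurable fun u => min (dens Q x x' x u) (dens Q x x' x' u) :=
  (measurable_dens Q x x' x).min (measurable_dens Q x x' x')

lemma commonPart_univ (Q : Kernel S S) [IsMarkovKernel Q] (x x' : S) :
    commonPart Q x x' Set.univ = kappa Q x x' := by
  rw [commonPart, withDensity_apply _ MeasurableSet.univ, Measure.restrict_univ, ← kappa_eq]

instance (Q : Kernel S S) [IsMarkovKernel Q] (x x' : S) : IsFiniteMeasure (commonPart Q x x') :=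
  ⟨by rw [commonPart_univ]; exact (kappa_le_one Q x x').trans_lt ENNReal.one_lt_top⟩

lemma withDensity_dens_left (Q : Kernel S S) [IsMarkovKernel Q] (x x' : S) :
    (refMeasure Q x x').withDensity (dens Q x x' x) = Q x :=
  Measure.withDensity_rnDeriv_eq _ _ (ac_left Q x x')

lemma withDensity_dens_right (Q : Kernel S S) [IsMarkovKernel Q] (x x' : S) :
    (refMeasure Q x x').withDensity (dens Q x x' x') = Q x' :=
  Measure.withDensity_rnDeriv_eq _ _ (ac_right Q x x')

/-- The common part is dominated by both probability measures, and at `κ = 1` it has full mass, so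
it equals both. This justifies the convention that both components then have the law `Q x`. -/
lemma commonPart_eq_of_kappa_eq_one (Q : Kernel S S) [IsMarkovKernel Q] {x x' : S}
    (h : kappa Q x x' = 1) : commonPart Q x x' = Q x ∧ commonPart Q x x' = Q x' := by
  constructor <;> refine Measure.eq_of_le_of_measure_univ_eq ?_ (by
    rw [commonPart_univ, h, measure_univ])
  · rw [← withDensity_dens_left Q x x']
    exact withDensity_mono (ae_of_all _ fun u => min_le_left _ _)
  · conv_rhs => rw [← withDensity_dens_right Q x x']
    exact withDensity_mono (ae_of_all _ fun u => min_le_right _ _)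

/-- The weight `1 - κ` cancels the normalisation, being nonzero and finite. The truncated
subtraction is a true one because the minimum lies below `p`. -/
lemma commonPart_add_withDensity (Q : Kernel S S) [IsMarkovKernel Q] {x x' : S}
    (hk : kappa Q x x' ≠ 1) {p : S → ℝ≥0∞} (hp : Measurable p)
    (hle : ∀ u, min (dens Q x x' x u) (dens Q x x' x' u) ≤ p u) :
    commonPart Q x x' + (1 - kappa Q x x') • (refMeasure Q x x').withDensity
      (fun u => (p u - min (dens Q x x' x u) (dens Q x x' x' u)) / (1 - kappa Q x x'))
      = (refMeasure Q x x').withDensity p := by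
  have hlt : kappa Q x x' < 1 := lt_of_le_of_ne (kappa_le_one Q x x') hk
  have hmin := measurable_min_dens Q x x'
  have hquot : Measurable fun u =>
      (p u - min (dens Q x x' x u) (dens Q x x' x' u)) / (1 - kappa Q x x') :=
    (hp.sub hmin).div measurable_const
  rw [commonPart, ← withDensity_smul _ hquot, ← withDensity_add_left hmin]
  congr 1
  funext u
  simp only [Pi.add_apply, Pi.smul_apply, smul_eq_mul]
  rw [ENNReal.mul_div_cancel (tsub_pos_of_lt hlt).ne' (by simp), add_tsub_cancel_of_le (hle u)]

lemma commonPart_add_etaLaw₁ (Q : Kernel S S) [IsMarkovKernel Q] (x x' : S) :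
    commonPart Q x x' + (1 - kappa Q x x') • etaLaw₁ Q x x' = Q x := by
  by_cases hk : kappa Q x x' = 1
  · simp [hk, (commonPart_eq_of_kappa_eq_one Q hk).1]
  · rw [etaLaw₁, if_neg hk, commonPart_add_withDensity Q hk (measurable_dens Q x x' x)
      fun u => min_le_left _ _, withDensity_dens_left]

lemma commonPart_add_etaLaw₂ (Q : Kernel S S) [IsMarkovKernel Q] (x x' : S) :
    commonPart Q x x' + (1 - kappa Q x x') • etaLaw₂ Q x x' = Q x' := by
  by_cases hk : kappa Q x x' = 1
  · simp [hk, (commonPart_eq_of_kappa_eq_one Q hk).2]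
  · rw [etaLaw₂, if_neg hk, commonPart_add_withDensity Q hk (measurable_dens Q x x' x')
      fun u => min_le_right _ _, withDensity_dens_right]

/-! ### The action of kernels on bounded functions, and its differences. -/

lemma BddMeas.integrable {X : Type*} [MeasurableSpace X] (g : BddMeas ℝ X) (ν : Measure X)
    [IsFiniteMeasure ν] : Integrable (g : X → ℝ) ν :=
  Integrable.of_bound (BddMeas.measurable g).aestronglyMeasurable ‖g‖
    (ae_of_all _ (BddMeas.norm_apply_le g))

/-- The function `x ↦ ∫ g(y) K(x, dy)`. -/
def average (K : Kernel S S) [IsMarkovKernel K] (g : BddMeas ℝ S) : BddMeas ℝ S :=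
  BddMeas.mk (fun x => ∫ y, g y ∂(K x))
    (StronglyMeasurable.integral_kernel (BddMeas.measurable g).stronglyMeasurable).measurable ‖g‖
    fun x => by
      simpa using norm_integral_le_of_norm_le_const (μ := K x)
        (ae_of_all _ fun y => BddMeas.norm_apply_le g y)

/-- The function `(x, x') ↦ g(x) - g(x')`. -/
def difference (g : BddMeas ℝ S) : BddMeas ℝ (S × S) :=
  BddMeas.mk (fun x => g x.1 - g x.2)
    (((BddMeas.measurable g).comp measurable_fst).sub ((BddMeas.measurable g).comp measurable_snd))
    (‖g‖ + ‖g‖) fun _ => (norm_sub_le _ _).trans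
      (add_le_add (BddMeas.norm_apply_le g _) (BddMeas.norm_apply_le g _))

lemma average_one (g : BddMeas ℝ S) [IsMarkovKernel (1 : Kernel S S)] : average 1 g = g :=
  BddMeas.ext' fun x => by
    change ∫ y, g y ∂((Kernel.id : Kernel S S) x) = g x
    rw [Kernel.id_apply, integral_dirac' _ _ (BddMeas.measurable g).stronglyMeasurable]

/-- In a product of kernels the right factor is the first transition, so the averages compose in
reverse order. -/
lemma average_mul (η κ : Kernel S S) [IsMarkovKernel η] [IsMarkovKernel κ]
    [IsMarkovKernel (η * κ)] (g : BddMeas ℝ S) :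
    average (η * κ) g = average κ (average η g) :=
  BddMeas.ext' fun x => by
    change ∫ y, g y ∂((η * κ) x) = ∫ y, ∫ z, g z ∂(η y) ∂(κ x)
    exact Kernel.integral_comp (BddMeas.integrable g ((η * κ) x))

lemma average_congr {K L : Kernel S S} [IsMarkovKernel K] [IsMarkovKernel L] (h : K = L)
    (g : BddMeas ℝ S) : average K g = average L g := by
  subst h; rfl

/-- The common part contributes equally to both integrals and cancels. Since the integrand is a sum
of functions of one coordinate each, only the marginals of `etaLaw` matter, not the independence. -/
lemma integral_sub_integral_eq_Vfun (Q : Kernel S S) [IsMarkovKernel Q] (g : BddMeas ℝ S)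
    (x : S × S) :
    ∫ y, g y ∂(Q x.1) - ∫ y, g y ∂(Q x.2) = Vfun Q (fun y => g y.1 - g y.2) x := by
  have hfin : 1 - kappa Q x.1 x.2 ≠ ∞ := by simp
  have h₁ : ∫ y, g y ∂(Q x.1) = ∫ y, g y ∂(commonPart Q x.1 x.2)
      + (1 - kappa Q x.1 x.2).toReal * ∫ y, g y ∂(etaLaw₁ Q x.1 x.2) := by
    conv_lhs => rw [← commonPart_add_etaLaw₁ Q x.1 x.2]
    rw [integral_add_measure (BddMeas.integrable g _)
      ((BddMeas.integrable g _).smul_measure hfin), integral_smul_measure, smul_eq_mul]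
  have h₂ : ∫ y, g y ∂(Q x.2) = ∫ y, g y ∂(commonPart Q x.1 x.2)
      + (1 - kappa Q x.1 x.2).toReal * ∫ y, g y ∂(etaLaw₂ Q x.1 x.2) := by
    conv_lhs => rw [← commonPart_add_etaLaw₂ Q x.1 x.2]
    rw [integral_add_measure (BddMeas.integrable g _)
      ((BddMeas.integrable g _).smul_measure hfin), integral_smul_measure, smul_eq_mul]
  rw [h₁, h₂, Vfun, etaLaw, integral_sub ((BddMeas.integrable g _).comp_fst _)
    ((BddMeas.integrable g _).comp_snd _), integral_fun_fst (fun y => g y),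
    integral_fun_snd (fun y => g y)]
  simp
  ring

/-! ### Iterates of `V`: intertwining, positivity, and passage to complex scalars. -/

section

variable {Q : Kernel S S} [IsMarkovKernel Q]

lemma V_apply {𝕜 : Type*} [RCLike 𝕜] (hQ : CouplingMeasurable Q) (h : BddMeas 𝕜 (S × S))
    (x : S × S) : V 𝕜 Q hQ h x = Vfun Q h x := rfl

lemma difference_average (hQ : CouplingMeasurable Q) (g : BddMeas ℝ S) :
    difference (average Q g) = V ℝ Q hQ (difference g) :=
  BddMeas.ext' fun x => integral_sub_integral_eq_Vfun Q g x

lemma difference_average_pow (hQ : CouplingMeasurable Q) (k : ℕ) (g : BddMeas ℝ S) :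
    difference (average (Q ^ k) g) = (V ℝ Q hQ ^ k) (difference g) := by
  induction k with
  | zero =>
    have : IsMarkovKernel (1 : Kernel S S) := (inferInstance : IsMarkovKernel (Q ^ 0))
    rw [average_congr (pow_zero Q), average_one]
    rfl
  | succ k ih =>
    have : IsMarkovKernel (Q ^ k * Q) := by rw [← pow_succ]; infer_instance
    rw [average_congr (pow_succ Q k), average_mul, difference_average hQ, ih, pow_succ']
    rfl

lemma abs_V_apply_le (hQ : CouplingMeasurable Q) {f h : BddMeas ℝ (S × S)}
    (hfh : ∀ x, |f x| ≤ h x) (x : S × S) : |V ℝ Q hQ f x| ≤ V ℝ Q hQ h x := by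
  simp only [V_apply, Vfun, RCLike.ofReal_real_eq_id, id_eq, abs_mul,
    abs_of_nonneg ENNReal.toReal_nonneg]
  gcongr
  exact abs_integral_le_integral_abs.trans
    (integral_mono (integrable_etaLaw Q f x).abs (integrable_etaLaw Q h x) hfh)

lemma abs_V_pow_apply_le (hQ : CouplingMeasurable Q) {f h : BddMeas ℝ (S × S)}
    (hfh : ∀ x, |f x| ≤ h x) (k : ℕ) (x : S × S) :
    |(V ℝ Q hQ ^ k) f x| ≤ (V ℝ Q hQ ^ k) h x := by
  induction k generalizing x with
  | zero => exact hfh x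
  | succ k ih =>
    rw [pow_succ']
    exact abs_V_apply_le hQ ih x

set_option synthInstance.maxHeartbeats 400000 in
set_option maxHeartbeats 1000000 in
-- Links the real iterates in the integral to the complex operator, whose norm and spectral radius
-- give the final bound.
lemma V_pow_one_complex (hQ : CouplingMeasurable Q) (k : ℕ) (x : S × S) :
    (V ℂ Q hQ ^ k) (BddMeas.one ℂ (S × S)) x
      = (((V ℝ Q hQ ^ k) (BddMeas.one ℝ (S × S)) x : ℝ) : ℂ) := by
  induction k generalizing x with
  | zero => simp [BddMeas.one]
  | succ k ih =>
    rw [pow_succ', pow_succ']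
    change Vfun Q ((V ℂ Q hQ ^ k) (BddMeas.one ℂ (S × S))) x
      = ((Vfun Q ((V ℝ Q hQ ^ k) (BddMeas.one ℝ (S × S))) x : ℝ) : ℂ)
    simp only [Vfun, ih, integral_complex_ofReal]
    simp

end

/-! ### The total variation bound -/

/-- The indicator function of a measurable set as a bounded measurable function. -/
def indicatorBdd {A : Set S} (hA : MeasurableSet A) : BddMeas ℝ S :=
  BddMeas.mk (A.indicator fun _ => 1) (measurable_const.indicator hA) 1 fun x => by
    by_cases h : x ∈ A <;> simp [h]

lemma average_indicatorBdd (K : Kernel S S) [IsMarkovKernel K] {A : Set S} (hA : MeasurableSet A)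
    (x : S) : average K (indicatorBdd hA) x = (K x).real A := by
  change ∫ y, A.indicator (fun _ => (1 : ℝ)) y ∂(K x) = _
  rw [integral_indicator_const _ hA, smul_eq_mul, mul_one]

lemma invariant_pow {P : Kernel S S} {μ : Measure S} (hμ : P.Invariant μ) (n : ℕ) :
    (P ^ n).Invariant μ := by
  induction n with
  | zero =>
    rw [pow_zero]
    exact Measure.bind_dirac
  | succ n ih =>
    rw [pow_succ]
    exact ih.comp hμ

lemma integral_real_of_invariant {K : Kernel S S} [IsMarkovKernel K] {μ : Measure S}
    (hμ : K.Invariant μ) {A : Set S} (hA : MeasurableSet A) :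
    ∫ x, (K x).real A ∂μ = μ.real A := by
  rw [measureReal_def, ← hμ.def, Measure.bind_apply hA K.aemeasurable, hμ.def]
  exact integral_toReal (K.measurable_coe hA).aemeasurable
    (ae_of_all _ fun x => measure_lt_top _ _)

lemma abs_real_sub_real_le (P : Kernel S S) [IsMarkovKernel P] (m : ℕ)
    (hV : CouplingMeasurable (P ^ m)) (n : ℕ) {A : Set S} (hA : MeasurableSet A) (x₁ x₂ : S) :
    |((P ^ n) x₁).real A - ((P ^ n) x₂).real A|
      ≤ (V ℝ (P ^ m) hV ^ (n / m)) (BddMeas.one ℝ (S × S)) (x₁, x₂)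
        * Set.indicator {x₂ : S | x₁ ≠ x₂} (fun _ => (1 : ℝ)) x₂ := by
  by_cases hx : x₁ = x₂
  · simp [hx]
  have hind : Set.indicator {x₂ : S | x₁ ≠ x₂} (fun _ => (1 : ℝ)) x₂ = 1 :=
    Set.indicator_of_mem (s := {x₂ : S | x₁ ≠ x₂}) hx _
  -- The right factor acts first: `n / m` blocks of length `m`, then `n % m` single steps, which are
  -- absorbed into the test function `g`.
  have hn : P ^ n = P ^ (n % m) * (P ^ m) ^ (n / m) := by
    rw [← pow_mul, ← pow_add, Nat.mod_add_div]
  have : IsMarkovKernel (P ^ (n % m) * (P ^ m) ^ (n / m)) := by rw [← hn]; infer_instance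
  set g := average (P ^ (n % m)) (indicatorBdd hA) with hg
  have hdiff : ((P ^ n) x₁).real A - ((P ^ n) x₂).real A
      = (V ℝ (P ^ m) hV ^ (n / m)) (difference g) (x₁, x₂) := by
    rw [← difference_average_pow hV, ← average_mul, ← average_congr hn]
    change _ = average (P ^ n) (indicatorBdd hA) x₁ - average (P ^ n) (indicatorBdd hA) x₂
    rw [average_indicatorBdd, average_indicatorBdd]
  rw [hind, mul_one, hdiff]
  -- By positivity of `V` it suffices that `|g x - g x'| ≤ 1`, which holds because `g` takes values
  -- in `[0, 1]`.
  refine abs_V_pow_apply_le hV (fun x => ?_) _ _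
  change |g x.1 - g x.2| ≤ 1
  rw [hg, average_indicatorBdd, average_indicatorBdd, abs_sub_le_iff]
  have h0 : ∀ z, 0 ≤ ((P ^ (n % m)) z).real A := fun z => measureReal_nonneg
  have h1 : ∀ z, ((P ^ (n % m)) z).real A ≤ 1 := fun z => measureReal_le_one
  constructor <;> linarith [h0 x.1, h0 x.2, h1 x.1, h1 x.2]

/-- By the Hahn decomposition the total variation is `s i - s iᶜ` with `i` the positive set; each
term contributes at most `B`, whence the factor `2`. -/
lemma tvNorm_le_of_forall_abs_sub_le (μ ν : Measure S) [IsFiniteMeasure μ] [IsFiniteMeasure ν]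
    {B : ℝ} (h : ∀ A, MeasurableSet A → |μ.real A - ν.real A| ≤ B) :
    tvNorm μ ν ≤ ENNReal.ofReal (2 * B) := by
  set s := μ.toSignedMeasure - ν.toSignedMeasure with hs
  have happ : ∀ A, MeasurableSet A → |s A| ≤ B := fun A hA => by
    rw [hs, Measure.toSignedMeasure_sub_apply hA]
    exact h A hA
  obtain ⟨i, hi, hpos, hneg, hp, hn⟩ := s.toJordanDecomposition_spec
  have hfin : s.totalVariation Set.univ ≠ ∞ := by
    rw [SignedMeasure.totalVariation]; exact measure_ne_top _ _
  rw [tvNorm, ← hs, ← ENNReal.ofReal_toReal hfin]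
  refine ENNReal.ofReal_le_ofReal ?_
  rw [SignedMeasure.totalVariation, Measure.add_apply,
    ENNReal.toReal_add (measure_ne_top _ _) (measure_ne_top _ _), ← measureReal_def,
    ← measureReal_def, hp, hn, SignedMeasure.toMeasureOfZeroLE_real_apply _ _ _ MeasurableSet.univ,
    SignedMeasure.toMeasureOfLEZero_real_apply _ _ _ MeasurableSet.univ]
  simp only [Set.inter_univ]
  linarith [le_abs_self (s i), neg_abs_le (s iᶜ), happ i hi, happ _ hi.compl]

set_option synthInstance.maxHeartbeats 400000 in
set_option maxHeartbeats 1000000 in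
lemma abs_V_pow_mul_indicator_le {Q : Kernel S S} [IsMarkovKernel Q]
    (hQ : CouplingMeasurable Q) (k : ℕ) (x₁ x₂ : S) :
    |(V ℝ Q hQ ^ k) (BddMeas.one ℝ (S × S)) (x₁, x₂)
      * Set.indicator {x₂ : S | x₁ ≠ x₂} (fun _ => (1 : ℝ)) x₂| ≤ ‖V ℂ Q hQ ^ k‖ := by
  have hone : ‖BddMeas.one ℂ (S × S)‖ ≤ 1 :=
    BddMeas.norm_le zero_le_one fun x => by simp [BddMeas.one]
  have h1 : |(V ℝ Q hQ ^ k) (BddMeas.one ℝ (S × S)) (x₁, x₂)| ≤ ‖V ℂ Q hQ ^ k‖ := by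
    rw [← Real.norm_eq_abs, ← Complex.norm_real, ← V_pow_one_complex]
    exact (BddMeas.norm_apply_le _ _).trans
      ((V ℂ Q hQ ^ k).unit_le_opNorm _ hone)
  rw [abs_mul]
  refine (mul_le_of_le_one_right (abs_nonneg _) ?_).trans h1
  by_cases h : x₁ = x₂ <;> simp [Set.indicator, h]

/-! ### Integration of the pairwise bound against the stationary measure. -/

section

variable [MeasurableSingletonClass S]

lemma measurable_V_pow_mul_indicator {Q : Kernel S S} [IsMarkovKernel Q]
    (hQ : CouplingMeasurable Q) (k : ℕ) (x₁ : S) :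
    Measurable fun x₂ => (V ℝ Q hQ ^ k) (BddMeas.one ℝ (S × S)) (x₁, x₂)
      * Set.indicator {x₂ : S | x₁ ≠ x₂} (fun _ => (1 : ℝ)) x₂ := by
  have hset : MeasurableSet {x₂ : S | x₁ ≠ x₂} := by
    have : {x₂ : S | x₁ ≠ x₂} = {x₁}ᶜ := by ext; simp [eq_comm]
    rw [this]
    exact (measurableSet_singleton x₁).compl
  exact ((BddMeas.measurable _).comp measurable_prodMk_left).mul (measurable_const.indicator hset)

set_option synthInstance.maxHeartbeats 400000 in
set_option maxHeartbeats 1000000 in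
lemma integrable_V_pow_mul_indicator {Q : Kernel S S} [IsMarkovKernel Q]
    (hQ : CouplingMeasurable Q) (k : ℕ) (x₁ : S) (μ : Measure S) [IsFiniteMeasure μ] :
    Integrable (fun x₂ => (V ℝ Q hQ ^ k) (BddMeas.one ℝ (S × S)) (x₁, x₂)
      * Set.indicator {x₂ : S | x₁ ≠ x₂} (fun _ => (1 : ℝ)) x₂) μ :=
  Integrable.of_bound (measurable_V_pow_mul_indicator hQ k x₁).aestronglyMeasurable _
    (ae_of_all _ fun x₂ => abs_V_pow_mul_indicator_le hQ k x₁ x₂)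

/-- `‖P_x(n, ·) - μ‖_TV ≤ ∫ 2 (V^{(m)})^{[n/m]} 1(x, x') 1(x ≠ x') μ(dx')`. -/
lemma tvNorm_le_integral (P : Kernel S S) [IsMarkovKernel P] (μ : Measure S)
    [IsProbabilityMeasure μ] (hμ : P.Invariant μ) (m : ℕ) (hV : CouplingMeasurable (P ^ m))
    (x₁ : S) (n : ℕ) :
    tvNorm ((P ^ n) x₁) μ ≤ ENNReal.ofReal
      (∫ x₂, 2 * (V ℝ (P ^ m) hV ^ (n / m)) (BddMeas.one ℝ (S × S)) (x₁, x₂)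
        * Set.indicator {x₂ : S | x₁ ≠ x₂} (fun _ => (1 : ℝ)) x₂ ∂μ) := by
  simp only [mul_assoc, integral_const_mul]
  refine tvNorm_le_of_forall_abs_sub_le _ _ fun A hA => ?_
  have hint : Integrable (fun x₂ => ((P ^ n) x₂).real A) μ :=
    Integrable.of_bound ((P ^ n).measurable_coe hA).ennreal_toReal.aestronglyMeasurable 1
      (ae_of_all _ fun x => by
        rw [Real.norm_of_nonneg measureReal_nonneg]; exact measureReal_le_one)
  -- Stationarity writes `μ A` as the `μ`-average of `P^n(x₂, A)`, so the pairwise bound can be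
  -- integrated over `x₂`.
  have heq : ((P ^ n) x₁).real A - μ.real A
      = ∫ x₂, (((P ^ n) x₁).real A - ((P ^ n) x₂).real A) ∂μ := by
    rw [integral_sub (integrable_const _) hint,
      integral_real_of_invariant (invariant_pow hμ n) hA]
    simp
  rw [heq]
  exact abs_integral_le_integral_abs.trans (integral_mono ((integrable_const _).sub hint).abs
    (integrable_V_pow_mul_indicator hV _ x₁ μ) (abs_real_sub_real_le P m hV n hA x₁))

set_option synthInstance.maxHeartbeats 400000 in
set_option maxHeartbeats 1000000 in
lemma integral_le_norm_V_pow {Q : Kernel S S} [IsMarkovKernel Q]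
    (hQ : CouplingMeasurable Q) (k : ℕ) (x₁ : S) (μ : Measure S) [IsProbabilityMeasure μ] :
    ∫ x₂, 2 * (V ℝ Q hQ ^ k) (BddMeas.one ℝ (S × S)) (x₁, x₂)
      * Set.indicator {x₂ : S | x₁ ≠ x₂} (fun _ => (1 : ℝ)) x₂ ∂μ ≤ 2 * ‖V ℂ Q hQ ^ k‖ := by
  simp only [mul_assoc, integral_const_mul]
  gcongr
  have := integral_mono (integrable_V_pow_mul_indicator hQ k x₁ μ) (integrable_const ‖V ℂ Q hQ ^ k‖)
    fun x₂ => (le_abs_self _).trans (abs_V_pow_mul_indicator_le hQ k x₁ x₂)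
  simpa using this

end

/-! ### The spectral radius bound -/

/-- Measurability survives pointwise limits, so the subspace is closed. Completeness passes to the
bounded operators, where Gelfand's formula needs it. -/
instance completeSpace_bddMeas {𝕜 : Type*} [RCLike 𝕜] {X : Type*} [MeasurableSpace X] :
    CompleteSpace (BddMeas 𝕜 X) := by
  have hclosed : IsClosed (BddMeas 𝕜 X : Set (lp (fun _ : X => 𝕜) ∞)) := by
    refine IsSeqClosed.isClosed fun u f hu hf => ?_
    refine measurable_of_tendsto_metrizable (f := fun n => (u n : X → 𝕜)) hu ?_
    exact (lp.uniformContinuous_coe.continuous.tendsto f).comp hf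
  exact hclosed.completeSpace_coe

/-- If `r(a) < c` then `‖a ^ k‖ ≤ c ^ k` for large `k`. -/
lemma eventually_norm_pow_le_of_spectralRadius_lt {A : Type*} [NormedRing A] [NormedAlgebra ℂ A]
    [CompleteSpace A] (a : A) {c : ℝ} (h : spectralRadius ℂ a < ENNReal.ofReal c) :
    ∀ᶠ k : ℕ in atTop, ‖a ^ k‖ ≤ c ^ k := by
  have := (spectrum.pow_norm_pow_one_div_tendsto_nhds_spectralRadius a).eventually_lt_const h
  filter_upwards [this, eventually_ne_atTop 0] with k hk hk0
  have h1 : ‖a ^ k‖ ^ (1 / k : ℝ) ≤ c := (ENNReal.lt_ofReal_iff_toReal_lt (by simp)).1 hk |>.le.trans' (by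
    rw [ENNReal.toReal_ofReal (by positivity)])
  calc ‖a ^ k‖ = (‖a ^ k‖ ^ (1 / k : ℝ)) ^ k := by
        rw [one_div, Real.rpow_inv_natCast_pow (norm_nonneg _) hk0]
    _ ≤ c ^ k := by gcongr

lemma tendsto_natDiv_div (m : ℕ) :
    Tendsto (fun n : ℕ => ((n / m : ℕ) : ℝ) / n) atTop (𝓝 (1 / (m : ℝ))) := by
  have h := (tendsto_nat_floor_mul_div_atTop (R := ℝ) (a := 1 / (m : ℝ)) (by positivity)).comp
    (tendsto_natCast_atTop_atTop (R := ℝ))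
  refine h.congr fun n => ?_
  simp only [Function.comp_apply]
  rw [one_div_mul_eq_div, Nat.floor_div_natCast, Nat.floor_natCast]

/-- The prefactor `2` disappears after division by `n`, and `[n/m] / n` tends to `1/m`. -/
lemma limsup_log_le_of_eventually_le {u : ℕ → ℝ≥0∞} {m : ℕ} {c : ℝ} (hc : 0 < c)
    (h : ∀ᶠ n in atTop, u n ≤ ENNReal.ofReal (2 * c ^ (n / m))) :
    limsup (fun n : ℕ => ((1 / (n : ℝ) : ℝ) : EReal) * ENNReal.log (u n)) atTop
      ≤ ENNReal.log (ENNReal.ofReal c ^ (1 / (m : ℝ))) := by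
  have hlim : Tendsto (fun n : ℕ => (((1 / (n : ℝ)) * Real.log 2
      + (((n / m : ℕ) : ℝ) / n) * Real.log c : ℝ) : EReal)) atTop
      (𝓝 (ENNReal.log (ENNReal.ofReal c ^ (1 / (m : ℝ))))) := by
    rw [ENNReal.log_rpow, ENNReal.log_ofReal_of_pos hc, ← EReal.coe_mul]
    refine (continuous_coe_real_ereal.tendsto _).comp ?_
    simpa using (tendsto_one_div_atTop_nhds_zero_nat.mul_const (Real.log 2)).add
      ((tendsto_natDiv_div m).mul_const (Real.log c))
  rw [← hlim.limsup_eq]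
  refine limsup_le_limsup ?_
  filter_upwards [h] with n hn
  calc ((1 / (n : ℝ) : ℝ) : EReal) * ENNReal.log (u n)
      ≤ ((1 / (n : ℝ) : ℝ) : EReal) * ENNReal.log (ENNReal.ofReal (2 * c ^ (n / m))) :=
        mul_le_mul_of_nonneg_left (ENNReal.log_monotone hn)
          (EReal.coe_nonneg.2 (by positivity))
    _ = _ := by
        rw [ENNReal.log_ofReal_of_pos (by positivity), ← EReal.coe_mul,
          Real.log_mul two_ne_zero (by positivity), Real.log_pow]
        congr 1
        ring

/-- Gelfand's formula bounds the powers only by `c ^ k` with `c` strictly above the spectral radius,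
so `c` is let decrease to it. Continuity of `ENNReal.log` at `0` covers spectral radius zero, where
the bound is `-∞`. -/
lemma limsup_log_le_log_spectralRadius {E : Type*} [NormedAddCommGroup E] [NormedSpace ℂ E]
    [CompleteSpace E] (a : E →L[ℂ] E) {u : ℕ → ℝ≥0∞} {m : ℕ} (hm : 1 ≤ m)
    (h : ∀ n, u n ≤ ENNReal.ofReal (2 * ‖a ^ (n / m)‖)) :
    limsup (fun n : ℕ => ((1 / (n : ℝ) : ℝ) : EReal) * ENNReal.log (u n)) atTop
      ≤ ENNReal.log (spectralRadius ℂ a ^ (1 / (m : ℝ))) := by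
  by_cases hr : spectralRadius ℂ a = ∞
  · have : (0 : ℝ) < 1 / m := by positivity
    rw [hr, ENNReal.top_rpow_of_pos this]
    simp
  have : (𝓝[>] spectralRadius ℂ a).NeBot := nhdsGT_neBot_of_exists_gt ⟨∞, lt_top_iff_ne_top.2 hr⟩
  have hcont : Tendsto (fun c : ℝ≥0∞ => ENNReal.log (c ^ (1 / (m : ℝ)))) (𝓝[>] spectralRadius ℂ a)
      (𝓝 (ENNReal.log (spectralRadius ℂ a ^ (1 / (m : ℝ))))) :=
    ((ENNReal.continuous_log.comp (ENNReal.continuous_rpow_const)).tendsto _).mono_left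
      nhdsWithin_le_nhds
  refine ge_of_tendsto hcont ?_
  filter_upwards [self_mem_nhdsWithin,
    nhdsWithin_le_nhds (eventually_lt_nhds (lt_top_iff_ne_top.2 hr))] with c hc hctop
  have hc0 : 0 < c.toReal := ENNReal.toReal_pos (bot_le.trans_lt hc).ne' hctop.ne
  have hcc : ENNReal.ofReal c.toReal = c := ENNReal.ofReal_toReal hctop.ne
  rw [← hcc]
  refine limsup_log_le_of_eventually_le hc0 ?_
  have hk := eventually_norm_pow_le_of_spectralRadius_lt a (by rw [hcc]; exact hc)
  -- The bound holds for large exponents, and `n / m` tends to infinity because `m ≠ 0`.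
  filter_upwards [(Nat.tendsto_div_const_atTop (by lia : m ≠ 0)).eventually hk] with n hn
  refine (h n).trans (ENNReal.ofReal_le_ofReal ?_)
  gcongr

end MarkovCoupling

end

open MarkovCoupling in
/-- Here `(V ℝ (P ^ m) hV) ^ k` is the `k`-th power of the operator `V^{(m)}` on real bounded
measurable functions, the spectral radius is that of its complexification, and `ENNReal.log` is the
logarithm with values in `[-∞, ∞]` and `ln 0 = -∞`. -/
theorem theorem2 {S : Type*} [MeasurableSpace S] [MeasurableSingletonClass S]
    (P : Kernel S S) [IsMarkovKernel P]
    (μ : Measure S) [IsProbabilityMeasure μ] (hμ : P.Invariant μ)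
    (m : ℕ) (hm : 1 ≤ m) (hV : CouplingMeasurable (P ^ m)) (x₁ : S) :
    limsup (fun n : ℕ => ((1 / (n : ℝ) : ℝ) : EReal) * ENNReal.log (tvNorm ((P ^ n) x₁) μ)) atTop
      ≤ limsup (fun n : ℕ => ((1 / (n : ℝ) : ℝ) : EReal) * ENNReal.log (ENNReal.ofReal
          (∫ x₂, 2 * ((V ℝ (P ^ m) hV) ^ (n / m)) (BddMeas.one ℝ (S × S)) (x₁, x₂)
            * Set.indicator {x₂ : S | x₁ ≠ x₂} (fun _ => (1 : ℝ)) x₂ ∂μ))) atTop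
    ∧ limsup (fun n : ℕ => ((1 / (n : ℝ) : ℝ) : EReal) * ENNReal.log (ENNReal.ofReal
          (∫ x₂, 2 * ((V ℝ (P ^ m) hV) ^ (n / m)) (BddMeas.one ℝ (S × S)) (x₁, x₂)
            * Set.indicator {x₂ : S | x₁ ≠ x₂} (fun _ => (1 : ℝ)) x₂ ∂μ))) atTop
      ≤ ENNReal.log (spectralRadius ℂ (V ℂ (P ^ m) hV) ^ (1 / (m : ℝ))) := by
  refine ⟨?_, limsup_log_le_log_spectralRadius _ hm fun n =>
    ENNReal.ofReal_le_ofReal (integral_le_norm_V_pow hV (n / m) x₁ μ)⟩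
  refine limsup_le_limsup (Eventually.of_forall fun n => ?_)
  exact mul_le_mul_of_nonneg_left (ENNReal.log_monotone (tvNorm_le_integral P μ hμ m hV x₁ n))
    (EReal.coe_nonneg.2 (by positivity))
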